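/- Let $r$ and $d$ be fixed positive integers. Then there is a function $L:\mathbb{N}\to\mathbb{N}$ (depending on $r$ and $d$) with $L(t)=rt+o(t)$ as $t\to\infty$ such that the following holds for every positive integer $t$. Let $X=(x_i)_{i\in I}$, $|I|=L(t)$, be any family of $L(t)$ points of $\mathbb{R}^d$ with integer coordinates (repetitions are allowed; in particular, $X$ may be any set of $L(t)$ distinct points). Then there is a partition of the index set $I$ into $r$ sets $P_1,\dots,P_r$ such that for every $C\subseteq I$ with $|C|\le t$ the convex hulls $$\operatorname{conv}\{x_i : i\in P_1\setminus C\},\ \dots,\ \operatorname{conv}\{x_i : i\in P_r\setminus C\}$$ have a common point with integer coordinates (which may depend on $C$). -/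

import Mathlib

open Filter Asymptotics

/-- A point of `ℝ^d` all of whose coordinates are integers. -/
def IsIntegerPoint {d : ℕ} (x : EuclideanSpace ℝ (Fin d)) : Prop :=
  ∀ k : Fin d, ∃ m : ℤ, x k = (m : ℝ)

/-- The (possibly empty) sets `P j` form a partition of the finite index type `ι`. -/
def IsPartition {ι : Type*} {r : ℕ} (P : Fin r → Finset ι) : Prop :=
  (∀ j k : Fin r, j ≠ k → Disjoint (P j) (P k)) ∧ ∀ i : ι, ∃ j : Fin r, i ∈ P j

/-!
The partition is random: each point receives one of `r` colours uniformly at random. Suppose that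
after the deletion of `C` the convex hulls `K j` of the colour classes have no common integer point.
By Doignon's theorem (`exists_subfamily_card_le`, `exists_separating_halfSpaces`) there are already
`2 ^ d` open half-spaces, each containing one of the `K j`, that have no common integer point in a
cube around the given points. Let `U j` consist of the given points that are missed by one of the
half-spaces around `K j`. Every given point is an integer point, so the sets `U j` cover all `N`
points, whereas all points of colour `j` in `U j` must have been deleted.

Each `U j` is a union of at most `2 ^ d` traces of half-spaces, and the number of such unions is
polynomial in `N`, by Radon's theorem and the Sauer-Shelah lemma (`card_halfSpaceTraces_le`). A
Chernoff bound (`exists_balanced_colouring`) therefore provides, for each `ε > 0` and all large `N`,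
a colouring in which every such union `U` has at least `|U| / r - ε N` points of every colour.
Summation over `j` gives `|C| ≥ N / r - r ε N`. Hence `N` points tolerate every `t` that is smaller
than this bound, and `N = r t + o(t)` points suffice.
-/

/-! ### Doignon's theorem on a finite point set -/

/-- Among open half-spaces `f i < b i` such that each one is needed to exclude all points of `S`,
the thresholds can be raised until every half-space is blocked by a point of `S` that lies on its
boundary and strictly inside all the others. The set `U` collects the half-spaces already treated;
raising another threshold keeps their blocking points, since thresholds only increase. -/
theorem exists_le_blocking_points {E ι : Type*} [DecidableEq ι] (S : Finset E) (f : ι → E → ℝ)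
    (T : Finset ι) (b : ι → ℝ) (hcov : ∀ s ∈ S, ∃ i ∈ T, b i ≤ f i s)
    (hmin : ∀ i ∈ T, ∃ s ∈ S, ∀ k ∈ T, k ≠ i → f k s < b k) (U : Finset ι) (hU : U ⊆ T) :
    ∃ b' : ι → ℝ, (∀ i, b i ≤ b' i) ∧ (∀ s ∈ S, ∃ i ∈ T, b' i ≤ f i s) ∧
      ∀ i ∈ U, ∃ s ∈ S, f i s = b' i ∧ ∀ k ∈ T, k ≠ i → f k s < b' k := by
  classical
  induction U using Finset.induction_on with
  | empty => exact ⟨b, fun _ => le_rfl, hcov, by simp⟩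
  | insert i U hi ih =>
    obtain ⟨b', hle, hcov', hblock⟩ := ih ((Finset.subset_insert i U).trans hU)
    have hiT : i ∈ T := hU (Finset.mem_insert_self i U)
    -- The new threshold at `i` is the least value of `f i` on the points inside the other ones.
    obtain ⟨p, hp, hpmin⟩ := Finset.exists_min_image
      (S.filter fun s => ∀ k ∈ T, k ≠ i → f k s < b' k) (f i) (by
        obtain ⟨s, hs, h⟩ := hmin i hiT
        exact ⟨s, Finset.mem_filter.2 ⟨hs, fun k hk hki => (h k hk hki).trans_le (hle k)⟩⟩)
    obtain ⟨hpS, hpin⟩ := Finset.mem_filter.1 hp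
    have hbp : b' i ≤ f i p := by
      obtain ⟨k, hk, hkp⟩ := hcov' p hpS
      by_cases hki : k = i
      · exact hki ▸ hkp
      · exact absurd hkp (hpin k hk hki).not_ge
    have hup : ∀ k, b' k ≤ Function.update b' i (f i p) k := fun k => by
      by_cases hki : k = i
      · subst hki; simpa using hbp
      · simp [hki]
    refine ⟨Function.update b' i (f i p), fun k => (hle k).trans (hup k), fun s hs => ?_,
      fun k hk => ?_⟩
    · by_cases h : ∀ k ∈ T, k ≠ i → f k s < b' k
      · exact ⟨i, hiT, by simpa using hpmin s (Finset.mem_filter.2 ⟨hs, h⟩)⟩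
      · push Not at h
        obtain ⟨k, hk, hki, hks⟩ := h
        exact ⟨k, hk, by simpa [hki] using hks⟩
    · obtain rfl | hkU := Finset.mem_insert.1 hk
      · exact ⟨p, hpS, by simp, fun l hl hlk => by simpa [hlk] using hpin l hl hlk⟩
      · obtain ⟨s, hs, hks, h⟩ := hblock k hkU
        have hki : k ≠ i := fun h => hi (h ▸ hkU)
        exact ⟨s, hs, by simpa [hki] using hks, fun l hl hlk => (h l hl hlk).trans_le (hup l)⟩

/-- Doignon's theorem for half-spaces. Let `π` be a labelling such that `S` contains the midpoint
of any two of its points with the same label. If finitely many open half-spaces `f i < b i` have no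
common point in `S`, then some subfamily, no larger than the number of labels, has none either. -/
theorem exists_subfamily_card_le {E ι κ : Type*} [AddCommGroup E] [Module ℝ E] [DecidableEq ι]
    [Fintype κ] (S : Finset E) (π : E → κ)
    (hS : ∀ p ∈ S, ∀ q ∈ S, π p = π q → midpoint ℝ p q ∈ S) (f : ι → E →ₗ[ℝ] ℝ) (b : ι → ℝ)
    (T : Finset ι) (hcov : ∀ s ∈ S, ∃ i ∈ T, b i ≤ f i s) :
    ∃ T' ⊆ T, T'.card ≤ Fintype.card κ ∧ ∀ s ∈ S, ∃ i ∈ T', b i ≤ f i s := by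
  classical
  induction T using Finset.strongInduction with
  | H T ih =>
  by_cases hmin : ∀ i ∈ T, ∃ s ∈ S, ∀ k ∈ T, k ≠ i → f k s < b k
  · refine ⟨T, subset_rfl, ?_, hcov⟩
    obtain ⟨b', -, hcov', hblock⟩ :=
      exists_le_blocking_points S (fun i => f i) T b hcov hmin T subset_rfl
    choose! p hpS hpb hplt using hblock
    refine Finset.card_le_card_of_injOn (fun i => π (p i)) (fun _ _ => Finset.mem_univ _) ?_
    intro i hi j hj hij
    by_contra hne
    -- The midpoint of two blocking points would lie strictly inside all half-spaces.
    obtain ⟨k, hk, hkm⟩ := hcov' _ (hS _ (hpS i hi) _ (hpS j hj) hij)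
    have hle : ∀ l ∈ T, f k (p l) ≤ b' k := fun l hl => by
      by_cases h : k = l
      · subst h; exact (hpb k hk).le
      · exact (hplt l hl k hk h).le
    have hlt : f k (p i) < b' k ∨ f k (p j) < b' k := by
      by_cases h : k = i
      · exact .inr (hplt j hj k hk fun h' => hne (h.symm.trans h'))
      · exact .inl (hplt i hi k hk h)
    rw [midpoint_eq_smul_add, map_smul, map_add, smul_eq_mul, invOf_eq_inv] at hkm
    have h1 := hle i hi
    have h2 := hle j hj
    rcases hlt with h | h <;> linarith
  · push Not at hmin
    obtain ⟨i, hi, h⟩ := hmin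
    obtain ⟨T', hT', hcard, hcov'⟩ := ih (T.erase i) (Finset.erase_ssubset hi) fun s hs => by
      obtain ⟨k, hk, hki, hks⟩ := h s hs
      exact ⟨k, Finset.mem_erase.2 ⟨hki, hk⟩, hks⟩
    exact ⟨T', hT'.trans (Finset.erase_subset _ _), hcard, hcov'⟩

/-! ### Counting traces of half-spaces -/

/-- The indices of the points of the family `x` in the closed half-space `b ≤ f`. -/
noncomputable def halfSpaceTrace {E ι : Type*} [AddCommGroup E] [Module ℝ E] [Fintype ι]
    (x : ι → E) (f : E →ₗ[ℝ] ℝ) (b : ℝ) : Finset ι :=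
  open Classical in Finset.univ.filter fun i => b ≤ f (x i)

/-- All index sets that closed half-spaces cut out of the family `x`. -/
noncomputable def halfSpaceTraces {E ι : Type*} [AddCommGroup E] [Module ℝ E] [Fintype ι]
    (x : ι → E) : Finset (Finset ι) :=
  open Classical in Finset.univ.filter fun A => ∃ f b, A = halfSpaceTrace x f b

theorem halfSpaceTrace_mem {E ι : Type*} [AddCommGroup E] [Module ℝ E] [Fintype ι]
    (x : ι → E) (f : E →ₗ[ℝ] ℝ) (b : ℝ) : halfSpaceTrace x f b ∈ halfSpaceTraces x := by
  simp only [halfSpaceTraces, Finset.mem_filter, Finset.mem_univ, true_and]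
  exact ⟨f, b, rfl⟩

theorem mem_halfSpaceTrace {E ι : Type*} [AddCommGroup E] [Module ℝ E] [Fintype ι]
    {x : ι → E} {f : E →ₗ[ℝ] ℝ} {b : ℝ} {i : ι} : i ∈ halfSpaceTrace x f b ↔ b ≤ f (x i) := by
  simp [halfSpaceTrace]

/-- By Radon's theorem, half-spaces cannot shatter more than `d + 1` points in dimension `d`. -/
theorem card_le_of_shatters_halfSpaceTraces {E ι : Type*} [AddCommGroup E] [Module ℝ E]
    [FiniteDimensional ℝ E] [Fintype ι] [DecidableEq ι] (x : ι → E) (s : Finset ι)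
    (hs : (halfSpaceTraces x).Shatters s) : s.card ≤ Module.finrank ℝ E + 1 := by
  classical
  by_contra hcard
  have hdep : ¬ AffineIndependent ℝ (fun i : s => x i) := fun h => by
    have h1 := h.card_le_finrank_succ
    have h2 := Submodule.finrank_le (vectorSpan ℝ (Set.range fun i : s => x i))
    rw [Fintype.card_coe] at h1
    omega
  obtain ⟨I, z, hzI, hzc⟩ := Convex.radon_partition hdep
  obtain ⟨A, hA, hAI⟩ := hs (t := s.filter fun i => ∃ h : i ∈ s, (⟨i, h⟩ : s) ∈ I)
    (Finset.filter_subset _ _)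
  obtain ⟨f, b, rfl⟩ := (Finset.mem_filter.1 hA).2
  have hiff : ∀ i : s, b ≤ f (x i) ↔ i ∈ I := fun i => by
    have := Finset.ext_iff.1 hAI i
    simpa [mem_halfSpaceTrace] using this
  have h1 : z ∈ {y | b ≤ f y} := convexHull_min (by
    rintro _ ⟨i, hi, rfl⟩
    exact (hiff i).2 hi) (convex_halfSpace_ge f.isLinear b) hzI
  have h2 : z ∈ {y | f y < b} := convexHull_min (by
    rintro _ ⟨i, hi, rfl⟩
    exact not_le.1 fun h => hi ((hiff i).1 h)) (convex_halfSpace_lt f.isLinear b) hzc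
  exact (not_le.2 (Set.mem_ofPred.1 h2)) h1

theorem Nat.sum_Iic_choose_le (n m : ℕ) : ∑ k ∈ Finset.Iic m, n.choose k ≤ (n + 1) ^ m := by
  rw [add_pow, Nat.range_succ_eq_Iic]
  refine Finset.sum_le_sum fun k hk => ?_
  have h := Nat.choose_pos (Finset.mem_Iic.1 hk)
  calc n.choose k ≤ n ^ k := Nat.choose_le_pow n k
    _ ≤ _ := by simpa using Nat.le_mul_of_pos_right (n ^ k) h

theorem card_halfSpaceTraces_le {E ι : Type*} [AddCommGroup E] [Module ℝ E]
    [FiniteDimensional ℝ E] [Fintype ι] (x : ι → E) :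
    (halfSpaceTraces x).card ≤ (Fintype.card ι + 1) ^ (Module.finrank ℝ E + 1) := by
  classical
  have hvc : (halfSpaceTraces x).vcDim ≤ Module.finrank ℝ E + 1 :=
    Finset.sup_le fun s hs =>
      card_le_of_shatters_halfSpaceTraces x s (Finset.mem_shatterer.1 hs)
  calc (halfSpaceTraces x).card ≤ (halfSpaceTraces x).shatterer.card :=
        Finset.card_le_card_shatterer _
    _ ≤ ∑ k ∈ Finset.Iic (halfSpaceTraces x).vcDim, (Fintype.card ι).choose k :=
        Finset.card_shatterer_le_sum_vcDim
    _ ≤ (Fintype.card ι + 1) ^ (halfSpaceTraces x).vcDim := Nat.sum_Iic_choose_le _ _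
    _ ≤ _ := Nat.pow_le_pow_right (Nat.succ_pos _) hvc

/-- The unions of at most `m` members of a set family. -/
def boundedUnions {ι : Type*} [DecidableEq ι] (𝒜 : Finset (Finset ι)) (m : ℕ) :
    Finset (Finset ι) :=
  ((Finset.Iic m).biUnion fun k => 𝒜.powersetCard k).image fun B => B.biUnion id

theorem card_boundedUnions_le {ι : Type*} [DecidableEq ι] (𝒜 : Finset (Finset ι)) (m : ℕ) :
    (boundedUnions 𝒜 m).card ≤ (𝒜.card + 1) ^ m := by
  calc (boundedUnions 𝒜 m).card ≤ ((Finset.Iic m).biUnion fun k => 𝒜.powersetCard k).card :=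
        Finset.card_image_le
    _ ≤ ∑ k ∈ Finset.Iic m, (𝒜.powersetCard k).card := Finset.card_biUnion_le
    _ = ∑ k ∈ Finset.Iic m, 𝒜.card.choose k := by simp_rw [Finset.card_powersetCard]
    _ ≤ _ := Nat.sum_Iic_choose_le _ _

theorem biUnion_mem_boundedUnions {ι α : Type*} [DecidableEq ι] {𝒜 : Finset (Finset ι)} {m : ℕ}
    {T : Finset α} {g : α → Finset ι} (hg : ∀ a ∈ T, g a ∈ 𝒜) (hT : T.card ≤ m) :
    T.biUnion g ∈ boundedUnions 𝒜 m := by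
  refine Finset.mem_image.2 ⟨T.image g, ?_, ?_⟩
  · exact Finset.mem_biUnion.2 ⟨_, Finset.mem_Iic.2 (Finset.card_image_le.trans hT),
      Finset.mem_powersetCard.2 ⟨Finset.image_subset_iff.2 hg, rfl⟩⟩
  · ext i; simp

/-! ### Random colourings -/

/-- The moment generating function of the deviation of one uniform colour from a fixed one. -/
theorem sum_exp_deviation_le {r : ℕ} (j : Fin r) {l : ℝ} (hl0 : 0 ≤ l) (hl1 : l ≤ 1) :
    ∑ a : Fin r, Real.exp (l * (1 / r - if a = j then 1 else 0)) ≤ r * Real.exp (l ^ 2) := by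
  have hr : (1 : ℝ) ≤ r := by exact_mod_cast j.pos
  have hr0 : (0 : ℝ) < r := by linarith
  have hinv0 : (0 : ℝ) ≤ 1 / r := by positivity
  have hinv1 : (1 : ℝ) / r ≤ 1 := by rw [div_le_one hr0]; exact hr
  have key : ∀ a : Fin r, Real.exp (l * (1 / r - if a = j then 1 else 0)) ≤
      1 + l * (1 / r - if a = j then 1 else 0) + l ^ 2 := fun a => by
    set y : ℝ := 1 / r - if a = j then 1 else 0 with hy
    have hy1 : |y| ≤ 1 := by
      rw [hy, abs_le]; split_ifs <;> constructor <;> linarith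
    have hly : |l * y| ≤ l := by
      rw [abs_mul, abs_of_nonneg hl0]; exact mul_le_of_le_one_right hl0 hy1
    have h1 := (abs_le.1 (Real.abs_exp_sub_one_sub_id_le (hly.trans hl1))).2
    have h2 : (l * y) ^ 2 ≤ l ^ 2 := sq_le_sq.2 (by rwa [abs_of_nonneg hl0])
    linarith
  calc _ ≤ ∑ a : Fin r, (1 + l * (1 / r - if a = j then 1 else 0) + l ^ 2) :=
        Finset.sum_le_sum fun a _ => key a
    _ = r * (l ^ 2 + 1) := by
        rw [Finset.sum_add_distrib, Finset.sum_add_distrib, ← Finset.mul_sum,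
          Finset.sum_sub_distrib]
        simp [hr0.ne']
        ring
    _ ≤ _ := by gcongr; exact Real.add_one_le_exp _

/-- A Chernoff bound: few colourings give the colour `j` to a share of `A` well below `1 / r`. -/
theorem card_unbalanced_colourings_le {ι : Type*} [Fintype ι] [DecidableEq ι] {r : ℕ} (j : Fin r)
    (A : Finset ι) {ε : ℝ} (hε0 : 0 ≤ ε) (hε1 : ε ≤ 1) :
    ((Finset.univ.filter fun c : ι → Fin r =>
        ((A.filter fun i => c i = j).card : ℝ) < A.card / r - ε * Fintype.card ι).card : ℝ) ≤
      (r : ℝ) ^ Fintype.card ι * Real.exp (-(ε ^ 2 / 4)) ^ Fintype.card ι := by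
  set n := Fintype.card ι with hn
  -- The parameter `l` of the exponential moment is chosen to minimise `l ^ 2 - l * ε`.
  set l := ε / 2 with hl
  let g : ι → Fin r → ℝ := fun i a =>
    if i ∈ A then Real.exp (l * (1 / r - if a = j then 1 else 0)) else 1
  have hprod : ∀ c : ι → Fin r, ∏ i, g i (c i) =
      Real.exp (l * (A.card / r - (A.filter fun i => c i = j).card)) := fun c => by
    rw [Finset.prod_ite_mem, Finset.univ_inter, ← Real.exp_sum, ← Finset.mul_sum,
      Finset.sum_sub_distrib]
    simp [div_eq_mul_inv]
  have htotal : ∑ c : ι → Fin r, ∏ i, g i (c i) ≤ (r * Real.exp (l ^ 2)) ^ n := by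
    have h := Finset.prod_univ_sum (fun _ : ι => (Finset.univ : Finset (Fin r))) g
    rw [Fintype.piFinset_univ] at h
    rw [← h, hn, ← Finset.card_univ, ← Finset.prod_const]
    refine Finset.prod_le_prod (fun i _ => Finset.sum_nonneg fun a _ => ?_) fun i _ => ?_
    · simp only [g]; split_ifs <;> positivity
    · by_cases hi : i ∈ A
      · simp only [g, hi, if_true]
        exact sum_exp_deviation_le j (by positivity) (by linarith)
      · simp only [g, hi, if_false, Finset.sum_const, Finset.card_univ, Fintype.card_fin,
          nsmul_eq_mul, mul_one]
        exact le_mul_of_one_le_right (by positivity) (Real.one_le_exp (by positivity))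
  set B := Finset.univ.filter fun c : ι → Fin r =>
    ((A.filter fun i => c i = j).card : ℝ) < A.card / r - ε * n
  have hmarkov : (B.card : ℝ) * Real.exp (l * (ε * n)) ≤ (r * Real.exp (l ^ 2)) ^ n := by
    rw [← nsmul_eq_mul]
    refine le_trans (Finset.card_nsmul_le_sum B (fun c => ∏ i, g i (c i)) _ fun c hc => ?_)
      (le_trans (Finset.sum_le_sum_of_subset_of_nonneg (Finset.subset_univ B) fun c _ _ => ?_)
        htotal)
    · have h := (Finset.mem_filter.1 hc).2
      rw [hprod, Real.exp_le_exp]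
      exact mul_le_mul_of_nonneg_left (by linarith) (by positivity)
    · rw [hprod]; positivity
  have hexp : (r * Real.exp (l ^ 2)) ^ n =
      ((r : ℝ) ^ n * Real.exp (-(ε ^ 2 / 4)) ^ n) * Real.exp (l * (ε * n)) := by
    rw [mul_pow, mul_assoc, ← Real.exp_nat_mul, ← Real.exp_nat_mul, ← Real.exp_add, hl]
    congr 2; ring
  rw [hexp] at hmarkov
  exact le_of_mul_le_mul_right hmarkov (Real.exp_pos _)

/-- The probabilistic method: a colouring exists in which every colour class takes almost its fair
share of every member of a family that is not too large. -/
theorem exists_balanced_colouring {ι : Type*} [Fintype ι] [DecidableEq ι] {r : ℕ} (hr : 0 < r)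
    (ℱ : Finset (Finset ι)) {ε : ℝ} (hε0 : 0 ≤ ε) (hε1 : ε ≤ 1)
    (hℱ : (r * ℱ.card : ℝ) * Real.exp (-(ε ^ 2 / 4)) ^ Fintype.card ι < 1) :
    ∃ c : ι → Fin r, ∀ A ∈ ℱ, ∀ j : Fin r,
      (A.card : ℝ) / r - ε * Fintype.card ι ≤ ((A.filter fun i => c i = j).card : ℝ) := by
  by_contra! hbad
  set B : Fin r × Finset ι → Finset (ι → Fin r) := fun p => Finset.univ.filter fun c =>
    ((p.2.filter fun i => c i = p.1).card : ℝ) < p.2.card / r - ε * Fintype.card ι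
  have hcover : (Finset.univ : Finset (ι → Fin r)) ⊆
      ((Finset.univ : Finset (Fin r)) ×ˢ ℱ).biUnion B := fun c _ => by
    obtain ⟨A, hA, j, hj⟩ := hbad c
    exact Finset.mem_biUnion.2 ⟨(j, A), by simp [hA], by simpa [B] using hj⟩
  have hcount : (r : ℝ) ^ Fintype.card ι ≤
      (r * ℱ.card) * ((r : ℝ) ^ Fintype.card ι * Real.exp (-(ε ^ 2 / 4)) ^ Fintype.card ι) := by
    calc (r : ℝ) ^ Fintype.card ι = ((Finset.univ : Finset (ι → Fin r)).card : ℝ) := by simp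
      _ ≤ ∑ p ∈ (Finset.univ : Finset (Fin r)) ×ˢ ℱ, ((B p).card : ℝ) := by
          exact_mod_cast (Finset.card_le_card hcover).trans Finset.card_biUnion_le
      _ ≤ ∑ p ∈ (Finset.univ : Finset (Fin r)) ×ˢ ℱ,
            ((r : ℝ) ^ Fintype.card ι * Real.exp (-(ε ^ 2 / 4)) ^ Fintype.card ι) :=
          Finset.sum_le_sum fun p _ => card_unbalanced_colourings_le p.1 p.2 hε0 hε1
      _ = _ := by simp [Finset.card_product]
  have hpos : (0 : ℝ) < (r : ℝ) ^ Fintype.card ι := by positivity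
  nlinarith

/-! ### Integer points and tolerant partitions -/

/-- Any finite family of integer points lies in a finite set of integer points that contains the
midpoint of any two of its points whose coordinates agree modulo `2`: the integer points of a
large cube. -/
theorem exists_finset_integerPoints {d : ℕ} {ι : Type*} [Fintype ι]
    (x : ι → EuclideanSpace ℝ (Fin d)) (hx : ∀ i, IsIntegerPoint (x i)) :
    ∃ S : Finset (EuclideanSpace ℝ (Fin d)), (∀ i, x i ∈ S) ∧ (∀ s ∈ S, IsIntegerPoint s) ∧
      ∃ π : EuclideanSpace ℝ (Fin d) → Fin d → ZMod 2,
        ∀ p ∈ S, ∀ q ∈ S, π p = π q → midpoint ℝ p q ∈ S := by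
  classical
  choose m hm using hx
  set M : ℤ := ∑ i, ∑ k, |m i k| with hM
  have hmM : ∀ i k, |m i k| ≤ M := fun i k =>
    (Finset.single_le_sum (f := fun k => |m i k|) (fun _ _ => abs_nonneg _)
      (Finset.mem_univ k)).trans
    (Finset.single_le_sum (f := fun i => ∑ k, |m i k|)
      (fun _ _ => Finset.sum_nonneg fun _ _ => abs_nonneg _) (Finset.mem_univ i))
  let e : (Fin d → ℤ) → EuclideanSpace ℝ (Fin d) := fun z => WithLp.toLp 2 fun k => (z k : ℝ)
  refine ⟨(Finset.Icc (fun _ => -M) (fun _ => M)).image e, fun i => ?_, fun s hs => ?_,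
    fun p k => (⌊p k⌋ : ZMod 2), fun p hp q hq hpq => ?_⟩
  · refine Finset.mem_image.2 ⟨m i, Finset.mem_Icc.2
      ⟨fun k => (abs_le.1 (hmM i k)).1, fun k => (abs_le.1 (hmM i k)).2⟩, ?_⟩
    ext k
    simp [e, hm]
  · obtain ⟨z, -, rfl⟩ := Finset.mem_image.1 hs
    exact fun k => ⟨z k, rfl⟩
  · obtain ⟨u, hu, rfl⟩ := Finset.mem_image.1 hp
    obtain ⟨v, hv, rfl⟩ := Finset.mem_image.1 hq
    rw [Finset.mem_Icc] at hu hv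
    have hpar : ∀ k, ∃ w, u k + v k = 2 * w := fun k => by
      have h := congrFun hpq k
      simp only [e, Int.floor_intCast] at h
      have h2 := (ZMod.intCast_eq_intCast_iff_dvd_sub _ _ 2).1 h
      push_cast at h2
      obtain ⟨w, hw⟩ := h2
      exact ⟨u k + w, by linarith⟩
    choose w hw using hpar
    refine Finset.mem_image.2 ⟨w, Finset.mem_Icc.2 ⟨fun k => ?_, fun k => ?_⟩, ?_⟩
    · have h1 := hu.1 k
      have h2 := hv.1 k
      have h3 := hw k
      simp only at h1 h2 ⊢
      linarith
    · have h1 := hu.2 k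
      have h2 := hv.2 k
      have h3 := hw k
      simp only at h1 h2 ⊢
      linarith
    · ext k
      have h : (u k : ℝ) + v k = 2 * w k := by exact_mod_cast hw k
      simp only [e, midpoint_eq_smul_add, PiLp.smul_apply, PiLp.add_apply, smul_eq_mul,
        invOf_eq_inv]
      linarith

/-- If the convex hulls of the subfamilies `Q j` have no common integer point, then there are at
most `2 ^ d` open half-spaces, the one labelled `s` containing the hull of `Q (σ s)`, such that
every `x i` lies outside one of them. -/
theorem exists_separating_halfSpaces {d r : ℕ} {ι : Type*} [Fintype ι]
    (x : ι → EuclideanSpace ℝ (Fin d)) (hx : ∀ i, IsIntegerPoint (x i)) (Q : Fin r → Set ι)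
    (hQ : ¬ ∃ z, IsIntegerPoint z ∧ ∀ j, z ∈ convexHull ℝ (x '' Q j)) :
    ∃ (T : Finset (EuclideanSpace ℝ (Fin d))) (σ : EuclideanSpace ℝ (Fin d) → Fin r)
      (f : EuclideanSpace ℝ (Fin d) → EuclideanSpace ℝ (Fin d) →ₗ[ℝ] ℝ)
      (b : EuclideanSpace ℝ (Fin d) → ℝ),
      T.card ≤ 2 ^ d ∧ (∀ i, ∃ s ∈ T, b s ≤ f s (x i)) ∧
        ∀ s ∈ T, ∀ i ∈ Q (σ s), f s (x i) < b s := by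
  classical
  obtain ⟨S, hxS, hSint, π, hπ⟩ := exists_finset_integerPoints x hx
  have hsep : ∀ s ∈ S, ∃ (j : Fin r) (f : EuclideanSpace ℝ (Fin d) →ₗ[ℝ] ℝ) (b : ℝ),
      b ≤ f s ∧ ∀ i ∈ Q j, f (x i) < b := fun s hs => by
    push Not at hQ
    obtain ⟨j, hj⟩ := hQ s (hSint s hs)
    obtain ⟨f, b, hlt, hs⟩ := geometric_hahn_banach_closed_point (convex_convexHull ℝ _)
      ((Set.toFinite (x '' Q j)).isClosed_convexHull ℝ) hj
    exact ⟨j, f.toLinearMap, b, hs.le, fun i hi =>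
      hlt _ (subset_convexHull ℝ _ (Set.mem_image_of_mem x hi))⟩
  obtain hι | ⟨⟨i₀⟩⟩ := isEmpty_or_nonempty ι
  · refine ⟨∅, ?_⟩
    push Not at hQ
    obtain ⟨j, -⟩ := hQ 0 fun k => ⟨0, by simp⟩
    exact ⟨fun _ => j, fun _ => 0, fun _ => 0, by simp⟩
  have : Nonempty (Fin r) := ⟨(hsep _ (hxS i₀)).choose⟩
  choose! σ f b hb hlt using hsep
  obtain ⟨T, hTS, hcard, hcov⟩ :=
    exists_subfamily_card_le S π hπ f b S fun s hs => ⟨s, hs, hb s hs⟩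
  exact ⟨T, σ, f, b, by simpa using hcard, fun i => hcov _ (hxS i), fun s hs => hlt s (hTS hs)⟩

/-- A colouring that is balanced on all unions of at most `2 ^ d` half-space traces has colour
classes whose convex hulls keep a common integer point after the deletion of `t` points. -/
theorem exists_common_integerPoint_of_balanced {d r t : ℕ} (hr : 0 < r) {ι : Type*} [Fintype ι]
    [DecidableEq ι] (x : ι → EuclideanSpace ℝ (Fin d)) (hx : ∀ i, IsIntegerPoint (x i)) {δ : ℝ}
    (ht : t < (Fintype.card ι : ℝ) / r - r * δ) (c : ι → Fin r)
    (hc : ∀ A ∈ boundedUnions (halfSpaceTraces x) (2 ^ d), ∀ j : Fin r,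
      (A.card : ℝ) / r - δ ≤ ((A.filter fun i => c i = j).card : ℝ))
    (C : Finset ι) (hC : C.card ≤ t) :
    ∃ z, IsIntegerPoint z ∧ ∀ j : Fin r, z ∈ convexHull ℝ (x '' {i | c i = j ∧ i ∉ C}) := by
  classical
  by_contra hno
  obtain ⟨T, σ, f, b, hT, hcov, hlt⟩ :=
    exists_separating_halfSpaces x hx (fun j => {i | c i = j ∧ i ∉ C}) hno
  -- The points cut off by the half-spaces that contain the `j`-th hull.
  let U : Fin r → Finset ι := fun j =>
    (T.filter fun s => σ s = j).biUnion fun s => halfSpaceTrace x (f s) (b s)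
  have hU : ∀ j, U j ∈ boundedUnions (halfSpaceTraces x) (2 ^ d) := fun j =>
    biUnion_mem_boundedUnions (fun s _ => halfSpaceTrace_mem x _ _)
      ((Finset.card_filter_le _ _).trans hT)
  have hUcov : (Finset.univ : Finset ι) ⊆ Finset.univ.biUnion U := fun i _ => by
    obtain ⟨s, hs, h⟩ := hcov i
    exact Finset.mem_biUnion.2 ⟨σ s, Finset.mem_univ _, Finset.mem_biUnion.2
      ⟨s, Finset.mem_filter.2 ⟨hs, rfl⟩, mem_halfSpaceTrace.2 h⟩⟩
  have hUC : ∀ j, ((U j).filter fun i => c i = j) ⊆ C.filter fun i => c i = j := fun j i hi => by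
    obtain ⟨hi, hij⟩ := Finset.mem_filter.1 hi
    obtain ⟨s, hs, h⟩ := Finset.mem_biUnion.1 hi
    obtain ⟨hsT, hsj⟩ := Finset.mem_filter.1 hs
    refine Finset.mem_filter.2 ⟨?_, hij⟩
    by_contra hiC
    exact absurd (mem_halfSpaceTrace.1 h) (hlt s hsT i ⟨hij.trans hsj.symm, hiC⟩).not_ge
  have hr' : (0 : ℝ) < r := by exact_mod_cast hr
  have hcount : (Fintype.card ι : ℝ) / r - r * δ ≤ C.card := by
    calc (Fintype.card ι : ℝ) / r - r * δ ≤ (∑ j, ((U j).card : ℝ)) / r - r * δ := by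
          gcongr
          exact_mod_cast (Finset.card_le_card hUcov).trans Finset.card_biUnion_le
      _ = ∑ j, (((U j).card : ℝ) / r - δ) := by
          rw [Finset.sum_sub_distrib, Finset.sum_div]; simp
      _ ≤ ∑ j, ((C.filter fun i => c i = j).card : ℝ) := Finset.sum_le_sum fun j _ =>
          (hc _ (hU j) j).trans (by exact_mod_cast Finset.card_le_card (hUC j))
      _ = C.card := by
          rw [Finset.card_eq_sum_card_fiberwise (f := c) (t := Finset.univ) (by simp)]
          push_cast; rfl
  have : (C.card : ℝ) ≤ t := by exact_mod_cast hC
  linarith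

/-- Every family of `N` integer points in dimension `d` can be split into `r` parts whose convex
hulls keep a common integer point after the deletion of any `t` or fewer points. -/
def HasTolerantPartitions (r d t N : ℕ) : Prop :=
  ∀ x : Fin N → EuclideanSpace ℝ (Fin d), (∀ i, IsIntegerPoint (x i)) →
    ∃ P : Fin r → Finset (Fin N), IsPartition P ∧
      ∀ C : Finset (Fin N), C.card ≤ t →
        ∃ z : EuclideanSpace ℝ (Fin d), IsIntegerPoint z ∧
          ∀ j : Fin r, z ∈ convexHull ℝ (x '' {i | i ∈ P j ∧ i ∉ C})

theorem hasTolerantPartitions_of_lt {r d t N : ℕ} (hr : 0 < r) {ε : ℝ} (hε0 : 0 ≤ ε) (hε1 : ε ≤ 1)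
    (hN : (r : ℝ) * ((N : ℝ) + 2) ^ ((d + 1) * 2 ^ d) * Real.exp (-(ε ^ 2 / 4)) ^ N < 1)
    (ht : t < (N : ℝ) / r - r * (ε * N)) : HasTolerantPartitions r d t N := fun x hx => by
  have hcard : (boundedUnions (halfSpaceTraces x) (2 ^ d)).card ≤
      (N + 2) ^ ((d + 1) * 2 ^ d) := by
    rw [pow_mul]
    refine (card_boundedUnions_le _ _).trans (Nat.pow_le_pow_left ?_ _)
    have h := card_halfSpaceTraces_le x
    rw [finrank_euclideanSpace_fin, Fintype.card_fin] at h
    exact (Nat.succ_le_succ h).trans (Nat.pow_lt_pow_left (Nat.lt_succ_self (N + 1)) d.succ_ne_zero)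
  obtain ⟨c, hc⟩ := exists_balanced_colouring hr (boundedUnions (halfSpaceTraces x) (2 ^ d))
    hε0 hε1 (lt_of_le_of_lt (by
      rw [Fintype.card_fin]
      gcongr
      exact_mod_cast hcard) hN)
  refine ⟨fun j => Finset.univ.filter fun i => c i = j, ⟨fun j k hjk => ?_, fun i => ⟨c i, by simp⟩⟩,
    fun C hC => ?_⟩
  · exact Finset.disjoint_filter.2 fun i _ h1 h2 => hjk (h1.symm.trans h2)
  · simp only [Fintype.card_fin] at hc
    simpa using exists_common_integerPoint_of_balanced hr x hx (by simpa using ht) c hc C hC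

/-! ### The number of points needed -/

theorem eventually_mul_pow_mul_pow_lt_one (a : ℝ) (D : ℕ) {q : ℝ} (hq0 : 0 < q) (hq1 : q < 1) :
    ∀ᶠ N : ℕ in atTop, a * ((N : ℝ) + 2) ^ D * q ^ N < 1 := by
  have h1 := (tendsto_pow_const_mul_const_pow_of_abs_lt_one D
    (by rwa [abs_of_pos hq0] : |q| < 1)).comp (tendsto_add_atTop_nat 2)
  have h2 := (h1.const_mul (a / q ^ 2))
  rw [mul_zero] at h2
  filter_upwards [h2.eventually_lt_const one_pos] with N hN
  refine lt_of_eq_of_lt ?_ hN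
  simp only [Function.comp]
  push_cast
  rw [pow_add]
  field_simp

/-- For every `η > 0`, once `N` is large, `N` points suffice for every tolerance `t` with
`(r + η) t ≤ N`. -/
theorem eventually_hasTolerantPartitions {r : ℕ} (d : ℕ) (hr : 0 < r) {η : ℝ} (hη : 0 < η) :
    ∀ᶠ N : ℕ in atTop, ∀ t : ℕ, (r + η) * t ≤ N → HasTolerantPartitions r d t N := by
  have hr' : (0 : ℝ) < r := by exact_mod_cast hr
  -- With this `ε`, the loss `r * ε` is smaller than `1 / r - 1 / (r + η) = η / (r * (r + η))`.
  obtain ⟨ε, hε0, hε1, hε⟩ : ∃ ε : ℝ, 0 < ε ∧ ε ≤ 1 ∧ r * ε < 1 / r - 1 / (r + η) := by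
    have hgap : 0 < 1 / (r : ℝ) - 1 / (r + η) :=
      sub_pos.2 (one_div_lt_one_div_of_lt hr' (by linarith))
    refine ⟨min 1 ((1 / (r : ℝ) - 1 / (r + η)) / (2 * r)), by positivity, min_le_left _ _, ?_⟩
    calc (r : ℝ) * _ ≤ r * ((1 / (r : ℝ) - 1 / (r + η)) / (2 * r)) := by
          gcongr; exact min_le_right _ _
      _ = (1 / (r : ℝ) - 1 / (r + η)) / 2 := by field_simp
      _ < _ := half_lt_self hgap
  filter_upwards [eventually_mul_pow_mul_pow_lt_one r ((d + 1) * 2 ^ d)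
    (Real.exp_pos (-(ε ^ 2 / 4)))
    (by rw [← Real.exp_zero, Real.exp_lt_exp]; exact neg_lt_zero.2 (by positivity)),
    eventually_gt_atTop 0] with N hN hN0 t ht
  refine hasTolerantPartitions_of_lt hr hε0.le hε1 hN ?_
  have hN' : (0 : ℝ) < N := by exact_mod_cast hN0
  have h1 : (t : ℝ) ≤ N * (1 / (r + η)) := by
    rw [mul_one_div, le_div_iff₀ (by positivity)]; linarith
  have h2 := mul_lt_mul_of_pos_left hε hN'
  calc (t : ℝ) ≤ N * (1 / (r + η)) := h1
    _ < N * (1 / r) - N * (r * ε) := by linarith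
    _ = _ := by ring

theorem mainTheorem3 (r d : ℕ) (hr : 0 < r) (hd : 0 < d) :
    ∃ L : ℕ → ℕ,
      (fun t : ℕ => (L t : ℝ) - (r : ℝ) * (t : ℝ)) =o[atTop] (fun t : ℕ => (t : ℝ)) ∧
      ∀ t : ℕ, 0 < t →
        ∀ x : Fin (L t) → EuclideanSpace ℝ (Fin d), (∀ i, IsIntegerPoint (x i)) →
          ∃ P : Fin r → Finset (Fin (L t)), IsPartition P ∧
            ∀ C : Finset (Fin (L t)), C.card ≤ t →
              ∃ z : EuclideanSpace ℝ (Fin d), IsIntegerPoint z ∧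
                ∀ j : Fin r, z ∈ convexHull ℝ (x '' {i | i ∈ P j ∧ i ∉ C}) := by
  classical
  have hr' : (0 : ℝ) < r := by exact_mod_cast hr
  have hex : ∀ t, ∃ N, r * t ≤ N ∧ HasTolerantPartitions r d t N := fun t => by
    obtain ⟨N, hN, h1, h2⟩ := ((eventually_hasTolerantPartitions d hr one_pos).and
      ((eventually_ge_atTop (r * t)).and (eventually_ge_atTop ((r + 1) * t)))).exists
    exact ⟨N, h1, hN t (by exact_mod_cast h2)⟩
  -- `L t` is the least sufficient number of points that is at least `r * t`.
  refine ⟨fun t => Nat.find (hex t), ?_, fun t _ => (Nat.find_spec (hex t)).2⟩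
  refine isLittleO_iff.2 fun η hη => ?_
  -- Half of `η` goes into the number of points, the other half absorbs the rounding.
  have hev := (tendsto_nat_ceil_atTop.comp (tendsto_natCast_atTop_atTop.const_mul_atTop
    (by positivity : 0 < (r : ℝ) + η / 2))).eventually
      (eventually_hasTolerantPartitions d hr (half_pos hη))
  filter_upwards [hev, (tendsto_natCast_atTop_atTop (R := ℝ)).eventually_ge_atTop (2 / η)]
    with t ht hlarge
  have hceil := Nat.le_ceil (((r : ℝ) + η / 2) * t)
  have hge : (r : ℝ) * t ≤ (Nat.find (hex t) : ℝ) := by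
    exact_mod_cast (Nat.find_spec (hex t)).1
  have hmin : Nat.find (hex t) ≤ ⌈((r : ℝ) + η / 2) * t⌉₊ := by
    refine Nat.find_min' (hex t) ⟨?_, ht t hceil⟩
    have h : ((r * t : ℕ) : ℝ) ≤ ((r : ℝ) + η / 2) * t := by
      push_cast
      nlinarith [(Nat.cast_nonneg t : (0 : ℝ) ≤ t)]
    exact_mod_cast h.trans hceil
  have hle : (Nat.find (hex t) : ℝ) ≤ ((r : ℝ) + η / 2) * t + 1 :=
    (Nat.cast_le.2 hmin).trans (Nat.ceil_lt_add_one (by positivity)).le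
  have hround : 1 ≤ η / 2 * t := by
    rw [div_le_iff₀ hη] at hlarge
    linarith
  rw [Real.norm_of_nonneg (sub_nonneg.2 hge), Real.norm_of_nonneg (Nat.cast_nonneg t)]
  linarith
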